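/- Let $2^{\mathbb N}$ be the Cantor cube, i.e. the product of countably many copies of the discrete group $\mathbb Z/2\mathbb Z$, with the product topology and coordinatewise addition. A set $X\subseteq 2^{\mathbb N}$ is called $\mathcal M$-additive (meager-additive) if for every meager set $M\subseteq 2^{\mathbb N}$ the set $X+M=\{x+m : x\in X,\ m\in M\}$ is meager in $2^{\mathbb N}$. Let $f:2^{\mathbb N}\to 2^{\mathbb N}$ be a continuous mapping. If $X\subseteq 2^{\mathbb N}$ is $\mathcal M$-additive, then so is its image $f(X)$. -/

import Mathlib

open scoped Pointwise

/-- The Cantor cube `2^ℕ`: a product of copies of the discrete two-element group, with the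
coordinatewise addition modulo 2 and the product topology. -/
abbrev CantorCube : Type := ℕ → ZMod 2

/-- A set `X ⊆ 2^ℕ` is meager-additive if `X + M = {x + m : x ∈ X, m ∈ M}` is meager for every
meager set `M ⊆ 2^ℕ`. -/
def IsMeagerAdditive (X : Set CantorCube) : Prop :=
  ∀ M : Set CantorCube, IsMeagre M → IsMeagre (X + M)

open Filter Topology

/-! By Shelah's criterion (`isMeagerAdditive_iff`), `X` is meager-additive iff each interval
partition has a coarsening and a point `y` such that every `x ∈ X` matches `y` on a whole fine block
inside almost every coarse block. This passes to images: by compactness finitely many input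
coordinates determine a given output prefix. If `x` matches `y` on `[a k, a (k + 1))`, only its
first `a k` coordinates are unknown, so `2 ^ a k` output blocks suffice to try every guess, and one
guess is right. -/

theorem exists_forall_mem_Ico_eq {α : Type*} {P : ℕ → ℕ} (hP : StrictMono P) (T : ℕ → ℕ → α) :
    ∃ y : ℕ → α, ∀ n, ∀ i ∈ Set.Ico (P n) (P (n + 1)), y i = T n i := by
  refine ⟨fun i => T (Nat.findGreatest (fun n => P n ≤ i) i) i, fun n i hi => ?_⟩
  have h : Nat.findGreatest (fun n => P n ≤ i) i = n := by
    rw [Nat.findGreatest_eq_iff]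
    refine ⟨(hP.le_apply).trans hi.1, fun _ => hi.1, fun m hm _ hmi => ?_⟩
    have := hP.monotone (Nat.succ_le_of_lt hm)
    exact absurd (this.trans hmi) (not_le.2 hi.2)
  simp only [h]

namespace CantorCube

theorem exists_agree_subset_of_mem_nhds {x : CantorCube} {U : Set CantorCube} (hU : U ∈ 𝓝 x) :
    ∃ n, ∀ z : CantorCube, (∀ i < n, z i = x i) → z ∈ U := by
  obtain ⟨V, ⟨w, n, rfl⟩, hxV, hVU⟩ :=
    (PiNat.isTopologicalBasis_cylinders (fun _ : ℕ => ZMod 2)).mem_nhds_iff.1 hU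
  exact ⟨n, fun z hz => hVU fun i hi => (hz i hi).trans (hxV i hi)⟩

theorem isOpen_setOf_agree (x : CantorCube) (s : Set ℕ) (hs : s.Finite) :
    IsOpen {z : CantorCube | ∀ i ∈ s, z i = x i} := by
  have : {z : CantorCube | ∀ i ∈ s, z i = x i} = s.pi fun i => {x i} := by
    ext z; simp [Set.mem_pi]
  rw [this]
  exact isOpen_set_pi hs fun _ _ => isOpen_discrete _

/-- Beyond any position `p`, a finite block of coordinates can force a point out of a nowhere dense
set, whatever its first `p` coordinates. -/
theorem exists_block_avoiding {F : Set CantorCube} (hF : IsNowhereDense F) (p : ℕ) :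
    ∃ q : ℕ, ∃ t : CantorCube, ∀ z : CantorCube,
      (∀ i ∈ Set.Ico p q, z i = t i) → z ∉ F := by
  -- Translating by the finitely many points supported below `p` realizes every change of prefix; a
  -- point outside all these translates of `closure F` has a neighbourhood outside them.
  let D : Set CantorCube := Set.pi Set.univ fun i => if i < p then Set.univ else {0}
  have hD : D.Finite := by
    let r : (Fin p → ZMod 2) → CantorCube := fun s i => if h : i < p then s ⟨i, h⟩ else 0
    refine (Set.finite_range r).subset fun d hd => ⟨fun i => d i, ?_⟩
    funext i
    by_cases h : i < p
    · simp [r, h]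
    · have := hd i trivial
      simp only [h, if_false, Set.mem_singleton_iff] at this
      simp [r, h, this]
  have hmeag : IsMeagre (⋃ d ∈ D, (fun z : CantorCube => d + z) ⁻¹' closure F) := by
    refine isMeagre_biUnion hD.countable fun d _ => ?_
    refine IsNowhereDense.isMeagre ?_
    have hcl : IsClosed ((fun z : CantorCube => d + z) ⁻¹' closure F) :=
      isClosed_closure.preimage (continuous_const_add d)
    rw [hcl.isNowhereDense_iff]
    have := (Homeomorph.addLeft d).preimage_interior (closure F)
    rw [Homeomorph.coe_addLeft] at this
    rw [← this, hF, Set.preimage_empty]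
  have hclosed : IsClosed (⋃ d ∈ D, (fun z : CantorCube => d + z) ⁻¹' closure F) :=
    hD.isClosed_biUnion fun d _ => isClosed_closure.preimage (continuous_const_add d)
  obtain ⟨t, ht⟩ := (dense_of_mem_residual hmeag).nonempty
  obtain ⟨q, hq⟩ := exists_agree_subset_of_mem_nhds (hclosed.isOpen_compl.mem_nhds ht)
  refine ⟨q, t, fun z hz hzF => ?_⟩
  let z' : CantorCube := fun i => if i < p then t i else z i
  refine hq z' (fun i hi => ?_) ?_
  · by_cases h : i < p
    · simp [z', h]
    · simpa [z', h] using hz i ⟨not_lt.1 h, hi⟩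
  · simp only [Set.mem_iUnion]
    refine ⟨z - z', fun i _ => ?_, ?_⟩
    · by_cases h : i < p <;> simp [z', h]
    · simpa using subset_closure hzF

/-- Every meager set is contained in a set of points differing from a fixed `y` on almost all
blocks of some interval partition coarser than a prescribed one. -/
theorem exists_block_partition_of_isMeagre {M : Set CantorCube} (hM : IsMeagre M) {f : ℕ → ℕ}
    (hf : StrictMono f) :
    ∃ G : ℕ → ℕ, StrictMono G ∧ ∃ y : CantorCube, ∀ z ∈ M, ∀ᶠ n in atTop,
      ∃ i ∈ Set.Ico (f (G n)) (f (G (n + 1))), z i ≠ y i := by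
  obtain ⟨S, hS, hSc, hMS⟩ := isMeagre_iff_countable_union_isNowhereDense.1 hM
  have hne : (insert ∅ S).Nonempty := Set.insert_nonempty _ _
  obtain ⟨F, hF⟩ := (hSc.insert ∅).exists_eq_range hne
  have hFn : ∀ n, IsNowhereDense (F n) := fun n => by
    have : F n ∈ insert ∅ S := hF ▸ Set.mem_range_self n
    rcases this with h | h
    · rw [h]; exact isNowhereDense_empty
    · exact hS _ h
  have hacc : ∀ n, IsNowhereDense (⋃ k ∈ Set.Iic n, F k) := fun n => by
    induction n with
    | zero => simpa using hFn 0
    | succ n ih =>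
      rw [show Set.Iic (n + 1) = insert (n + 1) (Set.Iic n) by ext; simp; omega,
        Set.biUnion_insert]
      rw [IsNowhereDense, closure_union,
        interior_union_isClosed_of_interior_empty isClosed_closure ih]
      exact hFn (n + 1)
  choose q t hqt using fun n p => exists_block_avoiding (hacc n) p
  -- Block `n` must reach `q n (f (G n))`; `G (n + 1) ≤ f (G (n + 1))` ensures it.
  let G : ℕ → ℕ := fun n => Nat.rec 0 (fun n g => max (g + 1) (q n (f g))) n
  have hG : ∀ n, G (n + 1) = max (G n + 1) (q n (f (G n))) := fun _ => rfl
  have hGm : StrictMono G := strictMono_nat_of_lt_succ fun n => by rw [hG]; omega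
  obtain ⟨y, hy⟩ := exists_forall_mem_Ico_eq (hf.comp hGm) fun n => t n (f (G n))
  refine ⟨G, hGm, y, fun z hz => ?_⟩
  obtain ⟨A, hA, hzA⟩ := hMS hz
  obtain ⟨N, rfl⟩ : A ∈ Set.range F := hF ▸ Set.mem_insert_of_mem _ hA
  filter_upwards [eventually_ge_atTop N] with n hn
  by_contra! hcon
  refine hqt n (f (G n)) z (fun i hi => ?_) (Set.mem_biUnion (show N ∈ Set.Iic n from hn) hzA)
  have hi' : i ∈ Set.Ico (f (G n)) (f (G (n + 1))) :=
    ⟨hi.1, hi.2.trans_le ((le_max_right _ _).trans ((hG n).ge.trans hf.le_apply))⟩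
  rw [hcon i hi', hy n i hi']

theorem isMeagre_setOf_eventually_ne {g : ℕ → ℕ} (hg : StrictMono g) (y : CantorCube) :
    IsMeagre {z : CantorCube | ∀ᶠ n in atTop, ∃ i ∈ Set.Ico (g n) (g (n + 1)), z i ≠ y i} := by
  have : {z : CantorCube | ∀ᶠ n in atTop, ∃ i ∈ Set.Ico (g n) (g (n + 1)), z i ≠ y i} =
      ⋃ N, ⋂ n ∈ Set.Ici N, {z : CantorCube | ∀ i ∈ Set.Ico (g n) (g (n + 1)), z i = y i}ᶜ := by
    ext z
    simp [eventually_atTop, and_assoc]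
  rw [this]
  refine isMeagre_iUnion fun N => IsNowhereDense.isMeagre ?_
  rw [IsClosed.isNowhereDense_iff (isClosed_biInter fun n _ =>
    (isOpen_setOf_agree y _ (Set.finite_Ico _ _)).isClosed_compl)]
  refine Set.eq_empty_of_forall_notMem fun x hx => ?_
  obtain ⟨m, hm⟩ := exists_agree_subset_of_mem_nhds (mem_interior_iff_mem_nhds.1 hx)
  have h := hm (fun i => if i < m then x i else y i) fun i hi => by simp [hi]
  rw [Set.mem_iInter₂] at h
  refine h (max N m) (Set.mem_Ici.2 (le_max_left _ _)) fun i hi => ?_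
  have : m ≤ i := (le_max_right N m).trans (hg.le_apply.trans hi.1)
  simp [not_lt.2 this]

/-- Shelah's combinatorial characterization of meager-additive sets. -/
theorem isMeagerAdditive_iff {X : Set CantorCube} :
    IsMeagerAdditive X ↔ ∀ f : ℕ → ℕ, StrictMono f → ∃ G : ℕ → ℕ, StrictMono G ∧
      ∃ y : CantorCube, ∀ x ∈ X, ∀ᶠ n in atTop, ∃ k ∈ Set.Ico (G n) (G (n + 1)),
        ∀ i ∈ Set.Ico (f k) (f (k + 1)), x i = y i := by
  constructor
  · intro hX f hf
    have hM := hX _ (isMeagre_setOf_eventually_ne hf 0)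
    obtain ⟨G, hG, y, hy⟩ := exists_block_partition_of_isMeagre hM hf
    refine ⟨G, hG, y, fun x hx => ?_⟩
    by_contra hcon
    rw [not_eventually] at hcon
    push Not at hcon
    -- On bad coarse blocks `m` makes `x + m = y`, and badness makes `m` nonzero on each fine block
    -- there; the value 1 does so elsewhere. Thus `m` lies in the meager set, yet `x + m` equals `y`
    -- on infinitely many coarse blocks.
    obtain ⟨m, hm⟩ := exists_forall_mem_Ico_eq (hf.comp hG) fun n i =>
      open Classical in
      if ∀ k ∈ Set.Ico (G n) (G (n + 1)), ∃ i ∈ Set.Ico (f k) (f (k + 1)), x i ≠ y i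
      then y i - x i else 1
    have hmM : ∀ k ≥ G 0, ∃ i ∈ Set.Ico (f k) (f (k + 1)), m i ≠ 0 := by
      intro k hk
      obtain ⟨n, hn⟩ : ∃ n, k ∈ Set.Ico (G n) (G (n + 1)) := by
        let n := Nat.findGreatest (fun n => G n ≤ k) k
        refine ⟨n, Nat.findGreatest_spec (P := fun n => G n ≤ k) (Nat.zero_le k) hk, ?_⟩
        by_contra! h
        have := Nat.le_findGreatest (P := fun n => G n ≤ k) (hG.le_apply.trans h) h
        omega
      have hsub : ∀ i ∈ Set.Ico (f k) (f (k + 1)), i ∈ Set.Ico (f (G n)) (f (G (n + 1))) :=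
        fun i hi => ⟨(hf.monotone hn.1).trans hi.1, hi.2.trans_le (hf.monotone hn.2)⟩
      by_cases hb : ∀ k ∈ Set.Ico (G n) (G (n + 1)), ∃ i ∈ Set.Ico (f k) (f (k + 1)), x i ≠ y i
      · obtain ⟨i, hi, hxy⟩ := hb k hn
        refine ⟨i, hi, ?_⟩
        rw [hm n i (hsub i hi), if_pos hb]
        exact sub_ne_zero.2 hxy.symm
      · have hi : f k ∈ Set.Ico (f k) (f (k + 1)) := ⟨le_rfl, hf (Nat.lt_succ_self k)⟩
        refine ⟨f k, hi, ?_⟩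
        rw [hm n _ (hsub _ hi), if_neg hb]
        exact one_ne_zero
    have hev := hy (x + m) (Set.add_mem_add hx (eventually_atTop.2 ⟨G 0, hmM⟩))
    obtain ⟨n, hb, i, hi, hne⟩ := (hcon.and_eventually hev).exists
    apply hne
    rw [Pi.add_apply, hm n i hi, if_pos hb, add_sub_cancel]
  · intro h M hM
    obtain ⟨F, hF, w, hw⟩ := exists_block_partition_of_isMeagre hM strictMono_id
    obtain ⟨G, hG, y, hy⟩ := h F hF
    refine (isMeagre_setOf_eventually_ne (hF.comp hG) (y + w)).mono ?_
    rintro _ ⟨x, hx, m, hm, rfl⟩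
    obtain ⟨N, hN⟩ := eventually_atTop.1 (hw m hm)
    filter_upwards [hy x hx, eventually_ge_atTop N] with n ⟨k, hk, hxy⟩ hn
    obtain ⟨i, hi, hne⟩ := hN k (hn.trans (hG.le_apply.trans hk.1))
    refine ⟨i, ⟨(hF.monotone hk.1).trans hi.1, hi.2.trans_le (hF.monotone hk.2)⟩, ?_⟩
    simp only [Pi.add_apply]
    rw [hxy i hi]
    exact fun h => hne (add_left_cancel h)

theorem exists_modulus_of_continuous {φ : CantorCube → CantorCube} (hφ : Continuous φ) (n : ℕ) :
    ∃ h, ∀ x z : CantorCube, (∀ i < h, x i = z i) → ∀ i < n, φ x i = φ z i := by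
  have hloc : ∀ x : CantorCube, ∃ m, ∀ z : CantorCube, (∀ i < m, z i = x i) →
      ∀ i < n, φ z i = φ x i := fun x =>
    exists_agree_subset_of_mem_nhds (hφ.continuousAt.preimage_mem_nhds
      ((isOpen_setOf_agree (φ x) (Set.Iio n) (Set.finite_Iio n)).mem_nhds fun _ _ => rfl))
  choose m hm using hloc
  obtain ⟨s, hs⟩ := CompactSpace.elim_nhds_subcover
    (fun x : CantorCube => {z : CantorCube | ∀ i ∈ Set.Iio (m x), z i = x i}) fun x =>
      (isOpen_setOf_agree x _ (Set.finite_Iio _)).mem_nhds fun _ _ => rfl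
  refine ⟨s.sup m, fun x z hxz i hi => ?_⟩
  have hx : x ∈ ⋃ c ∈ s, {z : CantorCube | ∀ i ∈ Set.Iio (m c), z i = c i} := hs ▸ trivial
  simp only [Set.mem_iUnion] at hx
  obtain ⟨c, hc, hxc⟩ := hx
  rw [hm c x hxc i hi, hm c z (fun j hj => ?_) i hi]
  rw [← hxz j (hj.trans_le (Finset.le_sup hc))]
  exact hxc j hj

theorem exists_enumeration_of_prefixes (a : ℕ) :
    ∃ E : ℕ → CantorCube, ∀ x : CantorCube, ∃ e < 2 ^ a, ∀ i < a, E e i = x i := by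
  have e : (Fin a → ZMod 2) ≃ Fin (2 ^ a) := Fintype.equivFinOfCardEq (by simp)
  refine ⟨fun k i => if h : k < 2 ^ a ∧ i < a then e.symm ⟨k, h.1⟩ ⟨i, h.2⟩ else 0,
    fun x => ⟨e fun i => x i, (e _).2, fun i hi => ?_⟩⟩
  simp [hi]

end CantorCube

open CantorCube in
theorem mainTheorem6 (f : CantorCube → CantorCube) (hf : Continuous f)
    (X : Set CantorCube) (hX : IsMeagerAdditive X) :
    IsMeagerAdditive (f '' X) := by
  rw [isMeagerAdditive_iff] at hX ⊢
  intro b hb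
  choose h hh using exists_modulus_of_continuous hf
  choose E hE using exists_enumeration_of_prefixes
  -- The pair is `(a n, j n)`: `j` leaves one output block per prefix of length `a n`, then `a (n +
  -- 1)` is large enough to determine all of them.
  let c : ℕ → ℕ × ℕ := fun n =>
    Nat.rec (0, 0) (fun _ r => (max (r.1 + 1) (h (b (r.2 + 2 ^ r.1))), r.2 + 2 ^ r.1)) n
  let a : ℕ → ℕ := fun n => (c n).1
  let j : ℕ → ℕ := fun n => (c n).2
  have hjs : ∀ n, j (n + 1) = j n + 2 ^ a n := fun _ => rfl
  have has : ∀ n, a (n + 1) = max (a n + 1) (h (b (j (n + 1)))) := fun _ => rfl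
  have ha : StrictMono a := strictMono_nat_of_lt_succ fun n => by rw [has]; omega
  have hj : StrictMono j := strictMono_nat_of_lt_succ fun n => by
    rw [hjs]; exact Nat.lt_add_of_pos_right (by positivity)
  obtain ⟨G, hG, y, hy⟩ := hX a ha
  -- `S (j k + e)` is the `e`-th guessed prefix continued by `y`.
  obtain ⟨S, hS⟩ := exists_forall_mem_Ico_eq (α := CantorCube) hj fun k l i =>
    if i < a k then E (a k) (l - j k) i else y i
  obtain ⟨y', hy'⟩ := exists_forall_mem_Ico_eq hb fun l i => f (S l) i
  refine ⟨j ∘ G, hj.comp hG, y', ?_⟩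
  rintro _ ⟨x, hx, rfl⟩
  filter_upwards [hy x hx] with n ⟨k, hk, hxy⟩
  obtain ⟨e, he, hex⟩ := hE (a k) x
  have hl : j k + e ∈ Set.Ico (j k) (j (k + 1)) := ⟨by omega, by rw [hjs]; omega⟩
  refine ⟨j k + e, ⟨(hj.monotone hk.1).trans hl.1, hl.2.trans_le (hj.monotone hk.2)⟩,
    fun i hi => ?_⟩
  rw [hy' _ i hi]
  refine hh (b (j (k + 1))) _ _ (fun i' hi' => ?_) i
    (hi.2.trans_le (hb.monotone hl.2))
  rw [hS k _ hl]
  by_cases hlt : i' < a k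
  · simp [hlt, hex i' hlt]
  · simp only [hlt, if_false]
    exact hxy i' ⟨not_lt.1 hlt, hi'.trans_le ((le_max_right _ _).trans (has k).ge)⟩
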